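/- For $d\ge 1$ let $$\mathcal O_d=\mathbb Q\Big[x_1,\dots,x_d,\tfrac1{x_1},\dots,\tfrac1{x_d},\Big(\tfrac1{x_i-x_j}\Big)_{1\le i<j\le d}\Big],\qquad \mathcal O=\prod_{d\ge1}\mathcal O_d ,$$ and write $f=(f^{(d)})_{d\ge1}$ for an element of $\mathcal O$. It is called homogeneous of weight $w$ if each $f^{(d)}$ is homogeneous of degree $w-d$. For a word $w=a_1\cdots a_r$ of length $r\ge1$ put $f(w)=f^{(r)}(a_1,\dots,a_r)$ and $f^\sharp(w)=f^{(r)}(a_1,a_1+a_2,\dots,a_1+\dots+a_r)$, extended linearly to linear combinations of words. The shuffle product of words is given by $1 \mathbin{\sqcup\!\!\sqcup} w=w \mathbin{\sqcup\!\!\sqcup} 1=w$ and $a u \mathbin{\sqcup\!\!\sqcup} b v=a(u \mathbin{\sqcup\!\!\sqcup} b v)+b(a u \mathbin{\sqcup\!\!\sqcup} v)$; the stuffle product of words, whose coefficients are rational functions of the letters, is given by $1*w=w*1=w$ and $$a u * b v=a(u*b v)+b(a u*v)+\frac{a(u*v)-b(u*v)}{a-b}\qquad(a\ne b),$$ where,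 for a letter $c$ and a combination $s$ of words, $c\,s$ denotes concatenation on the left. Let $\mathfrak{pdmr}\subset\mathcal O$ be the set of solutions of the double shuffle equations modulo products, i.e. of all $f\in\mathcal O$ such that for all $p,q\ge1$, in $\mathbb Q(x_1,\dots,x_{p+q})$, $$f^{\sharp}(x_1\cdots x_p \mathbin{\sqcup\!\!\sqcup} x_{p+1}\cdots x_{p+q})=0,\qquad f(x_1\cdots x_p * x_{p+1}\cdots x_{p+q})=0 .$$ A vine $v=g_{i_1}\cdots g_{i_k}$ with $d$ grapes is given by a sequence of integers $i_1,\dots,i_k\ge1$ with $i_1+\dots+i_k=d$; its height is $h(v)=k$. It is the tree with vertices $0,1,\dots,d$ and root $0$ in which, for $1\le\ell\le k$ and $m=i_1+\dots+i_{\ell-1}$, the vertex $m$ is joined by an edge to each of $m+1,\dots,m+i_\ell$. Put $x_0=0$ and $x_v=\prod(x_j-x_i)$, the product over the edges $\{i,j\}$, $i<j$, of $v$. Define $\psi_{-1}=(\psi_{-1}^{(d)})_{d\ge1}$ by $$\psi_{-1}^{(d)}=\sum_{v}\frac{(-1)^{h(v)+1}}{h(v)}\,\frac1{x_v\,x_d},$$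 where $v$ runs over all vines with $d$ grapes. **Theorem.** $\psi_{-1}$ is homogeneous of weight $-1$ and lies in $\mathfrak{pdmr}$; that is, $\psi_{-1}\in\mathcal O$ and it satisfies the double shuffle equations modulo products. -/

import Mathlib

noncomputable section

namespace PolarDoubleShuffle

/-! ### Rational functions, the rings of functions with poles, and substitution -/

/-- The field `ℚ(x_1, …, x_d)`. -/
abbrev RatFun (d : ℕ) : Type := FractionRing (MvPolynomial (Fin d) ℚ)

/-- The coordinates `x_0 = 0, x_1, …, x_d` of `ℚ(x_1, …, x_d)` (the value is `0` for an index
greater than `d`, which is never used). -/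
def coord (d : ℕ) : ℕ → RatFun d
  | 0 => 0
  | k + 1 => if h : k < d then algebraMap (MvPolynomial (Fin d) ℚ) (RatFun d) (.X ⟨k, h⟩) else 0

/-- The ring `𝒪_d = ℚ[x_i, 1/x_i, 1/(x_i - x_j)]`, as a subalgebra of `ℚ(x_1, …, x_d)`. -/
def polarRing (d : ℕ) : Subalgebra ℚ (RatFun d) :=
  Algebra.adjoin ℚ
    ({g | ∃ i, 1 ≤ i ∧ i ≤ d ∧ g = coord d i} ∪
     {g | ∃ i, 1 ≤ i ∧ i ≤ d ∧ g = (coord d i)⁻¹} ∪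
     {g | ∃ i j, 1 ≤ i ∧ i < j ∧ j ≤ d ∧ g = (coord d i - coord d j)⁻¹})

/-- Sequences `(f^{(d)})_{d ≥ 1}` of rational functions `f^{(d)} ∈ ℚ(x_1, …, x_d)`. -/
abbrev RatSeq : Type := ∀ d : ℕ+, RatFun d

/-- `𝒪 = ∏_{d ≥ 1} 𝒪_d`. -/
def polarSeries : Set RatSeq := {f | ∀ d : ℕ+, f d ∈ polarRing d}

/-- The value `f(a_1, …, a_d)` of a rational function at a tuple of elements of a field, computed
from its reduced fraction. It is the true value when the reduced denominator
does not vanish at `a`. -/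
def evalAt {K : Type*} [Field K] [Algebra ℚ K] {d : ℕ} (a : Fin d → K) (f : RatFun d) : K :=
  MvPolynomial.aeval a (IsFractionRing.num (MvPolynomial (Fin d) ℚ) f) /
    MvPolynomial.aeval a (IsFractionRing.den (MvPolynomial (Fin d) ℚ) f :
      MvPolynomial (Fin d) ℚ)

/-- A rational function is homogeneous of degree `m ∈ ℤ` if it is a quotient of homogeneous
polynomials whose degrees differ by `m`. -/
def IsHomogeneousRat {d : ℕ} (f : RatFun d) (m : ℤ) : Prop :=
  ∃ (p q : MvPolynomial (Fin d) ℚ) (a b : ℕ), p.IsHomogeneous a ∧ q.IsHomogeneous b ∧ q ≠ 0 ∧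
    (a : ℤ) - b = m ∧ f = algebraMap _ (RatFun d) p / algebraMap _ (RatFun d) q

/-- `f` is homogeneous of weight `w` if `f^{(d)}` is homogeneous of degree `w - d` for all
`d ≥ 1`. -/
def IsHomogeneousOfWeight (f : RatSeq) (w : ℤ) : Prop :=
  ∀ d : ℕ+, IsHomogeneousRat (f d) (w - (d : ℕ))

/-! ### The double shuffle equations modulo products

A word in letters from a field `K` is a list. A function `F : List K → K` is thought of as a
sequence of functions `F^{(r)}` of `r` variables, extended linearly to combinations of words. -/

/-- `f(a_1 … a_r) = f^{(r)}(a_1, …, a_r)` for a word of length `r ≥ 1`. (Depth `0` does not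
occur in the equations below; there the value is `0`.) -/
def evalWord {K : Type*} [Field K] [Algebra ℚ K] (f : RatSeq) : List K → K
  | [] => 0
  | a :: w => evalAt (a :: w).get (f ⟨w.length + 1, Nat.succ_pos _⟩)

/-- `F(u ⧢ v)`, where `u ⧢ v` is the shuffle product of words:
`a u ⧢ b v = a (u ⧢ b v) + b (a u ⧢ v)`. -/
def onShuffle {K : Type*} [Field K] : (List K → K) → List K → List K → K
  | F, [], v => F v
  | F, u, [] => F u
  | F, a :: u, b :: v =>
      onShuffle (fun w => F (a :: w)) u (b :: v) + onShuffle (fun w => F (b :: w)) (a :: u) v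
  termination_by _ u v => u.length + v.length

/-- `F(u * v)`, where `u * v` is the stuffle product:
`F(a u * b v) = F(a (u * b v)) + F(b (a u * v)) + (F(a (u * v)) - F(b (u * v))) / (a - b)`. -/
def onStuffle {K : Type*} [Field K] : (List K → K) → List K → List K → K
  | F, [], v => F v
  | F, u, [] => F u
  | F, a :: u, b :: v =>
      onStuffle (fun w => F (a :: w)) u (b :: v) + onStuffle (fun w => F (b :: w)) (a :: u) v +
        (onStuffle (fun w => F (a :: w)) u v - onStuffle (fun w => F (b :: w)) u v) / (a - b)
  termination_by _ u v => u.length + v.length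

/-- `F^♯(a_1 … a_r) = F(a_1, a_1 + a_2, …, a_1 + ⋯ + a_r)`. -/
def sharp {K : Type*} [Field K] (F : List K → K) (w : List K) : K :=
  F (w.scanl (· + ·) 0).tail

/-- The word `x_{m+1} x_{m+2} … x_{m+k}` in the coordinates of `ℚ(x_1, …, x_n)`. -/
def coordWord (n m k : ℕ) : List (RatFun n) :=
  (List.range k).map fun i => coord n (m + i + 1)

/-- The shuffle equations modulo products: for all `p, q ≥ 1`,
`(f^{(p+q)})^♯ (x_1 … x_p ⧢ x_{p+1} … x_{p+q}) = 0` in `ℚ(x_1, …, x_{p+q})`. -/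
def ShuffleEquations (f : RatSeq) : Prop :=
  ∀ p q : ℕ, 1 ≤ p → 1 ≤ q →
    onShuffle (sharp (evalWord f)) (coordWord (p + q) 0 p) (coordWord (p + q) p q) = 0

/-- The stuffle equations modulo products: for all `p, q ≥ 1`,
`f (x_1 … x_p * x_{p+1} … x_{p+q}) = 0` in `ℚ(x_1, …, x_{p+q})`. -/
def StuffleEquations (f : RatSeq) : Prop :=
  ∀ p q : ℕ, 1 ≤ p → 1 ≤ q →
    onStuffle (evalWord f) (coordWord (p + q) 0 p) (coordWord (p + q) p q) = 0

/-- `𝔭𝔡𝔪𝔯`: the solutions in `𝒪` of the double shuffle equations modulo products. -/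
def pdmr : Set RatSeq := {f | f ∈ polarSeries ∧ ShuffleEquations f ∧ StuffleEquations f}

/-! ### Vines and the element of weight `-1` -/

/-- A vine `g_{i_1} ⋯ g_{i_k}` with `n` grapes, given by the sequence of sizes `i_1, …, i_k ≥ 1`
of its bunches, where `i_1 + ⋯ + i_k = n`. Its vertices are labelled `0, …, n`. -/
abbrev Vine (n : ℕ) : Type := Composition n

/-- The height of a vine is its number of bunches. -/
def Vine.height {n : ℕ} (v : Vine n) : ℕ := Composition.length v

/-- The edges of the bunch `g_n` with stalk `i` and grapes `i + 1, …, i + n`. -/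
def bunchEdges (i n : ℕ) : Finset (ℕ × ℕ) :=
  (Finset.Icc (i + 1) (i + n)).image fun j => (i, j)

/-- The edges of `g_{i_1} g_{i_2} ⋯` with root `i`: the stalk of each bunch is the grape with the
highest label of the preceding part. -/
def graftEdges : ℕ → List ℕ → Finset (ℕ × ℕ)
  | _, [] => ∅
  | i, n :: l => bunchEdges i n ∪ graftEdges (i + n) l

/-- The edges `(i, j)`, `i < j`, of a vine with root `0`. -/
def Vine.edges {n : ℕ} (v : Vine n) : Finset (ℕ × ℕ) := graftEdges 0 v.blocks

/-- `x_v = ∏_{(i,j)} (x_j - x_i)`, the product over the edges of `v`, with `x_0 = 0`. -/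
def Vine.x {n : ℕ} (v : Vine n) : RatFun n :=
  ∏ e ∈ Vine.edges v, (coord n e.2 - coord n e.1)

/-- `ψ_{-1}^{(d)} = ∑_v (-1)^{h(v)+1} / (h(v) x_v x_d)`, over all vines `v` with `d` grapes. -/
def psiNegOne : RatSeq := fun d =>
  ∑ v : Vine d, (-1) ^ (Vine.height v + 1) / (Vine.height v : RatFun d) *
    (1 / (Vine.x v * coord d d))

end PolarDoubleShuffle

end

noncomputable section

namespace PolarDoubleShuffle

open Polynomial

/-! ### Module-valued shuffles and stuffles -/

section Words

variable {K : Type*} [Field K] {V W : Type*} [AddCommGroup V] [Module K V]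
  [AddCommGroup W] [Module K W]

/-! Sum `t^(h(v)-1) φ(last grape) / x_v` over all vines with root `y` and grapes a given word: this
is `vineSum`. Its recursion looks at the first grape `a`: it stays in a bunch with the next grape
(root `y` unchanged), or forms a bunch by itself (root moves to `a`, factor `t`), or is the only
grape. Up to the functional `t^(h-1) ↦ (-1)^(h+1)/h`, called `logMap`, `ψ_{-1}` is the case `y = 0`,
`φ(a) = 1/a` (`evalWord_psiNegOne`).

Stuffle: for `φ(a) = 1/(a - s)` and nonempty words, the value at `u * v` is `(y - s)(1 + t)` times
the product of the values at `u` and `v` (`stuffleSum_eval_vineSum`). It vanishes at `y = s = 0`,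
identically in `t`, so each height satisfies the equations separately.

Shuffle: after `♯` the last grape is the sum of all letters, a common factor of all terms, and `x_v`
becomes a product over bunches of products of partial sums. Thus the height `k` part is the `k`-th
convolution power of `χ - ε`, where `χ = 1/(a_1 (a_1 + a_2) ⋯)` and `ε` is the counit, and the sum
is `log χ`. Since `χ` is a character for the shuffle product, so are its powers `χ^n`; they are
polynomial in `n`, and the coefficient of `n` is `log χ`. A product of two polynomials without
constant term has no linear term, so `log χ` kills shuffles of nonempty words (`shuffleSum_log`). -/

/-- The value of a module-valued function on words at a shuffle product. -/
def shuffleSum {α V : Type*} [AddCommGroup V] : (List α → V) → List α → List α → V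
  | F, [], v => F v
  | F, u, [] => F u
  | F, a :: u, b :: v =>
      shuffleSum (fun w => F (a :: w)) u (b :: v) + shuffleSum (fun w => F (b :: w)) (a :: u) v
  termination_by _ u v => u.length + v.length

/-- The value of a module-valued function on words at a stuffle product. -/
def stuffleSum {K V : Type*} [Field K] [AddCommGroup V] [Module K V] :
    (List K → V) → List K → List K → V
  | F, [], v => F v
  | F, u, [] => F u
  | F, a :: u, b :: v =>
      stuffleSum (fun w => F (a :: w)) u (b :: v) + stuffleSum (fun w => F (b :: w)) (a :: u) v +
        (a - b)⁻¹ • (stuffleSum (fun w => F (a :: w)) u v - stuffleSum (fun w => F (b :: w)) u v)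
  termination_by _ u v => u.length + v.length

@[simp] theorem shuffleSum_nil_left {α : Type*} (F : List α → V) (v : List α) :
    shuffleSum F [] v = F v := by
  simp [shuffleSum]

@[simp] theorem shuffleSum_nil_right {α : Type*} (F : List α → V) (u : List α) :
    shuffleSum F u [] = F u := by
  cases u <;> simp [shuffleSum]

theorem shuffleSum_cons_cons {α : Type*} (F : List α → V) (a b : α) (u v : List α) :
    shuffleSum F (a :: u) (b :: v) =
      shuffleSum (fun w => F (a :: w)) u (b :: v) + shuffleSum (fun w => F (b :: w)) (a :: u) v := by
  rw [shuffleSum]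

@[simp] theorem stuffleSum_nil_left (F : List K → V) (v : List K) :
    stuffleSum F [] v = F v := by
  simp [stuffleSum]

@[simp] theorem stuffleSum_nil_right (F : List K → V) (u : List K) :
    stuffleSum F u [] = F u := by
  cases u <;> simp [stuffleSum]

theorem stuffleSum_cons_cons (F : List K → V) (a b : K) (u v : List K) :
    stuffleSum F (a :: u) (b :: v) =
      stuffleSum (fun w => F (a :: w)) u (b :: v) + stuffleSum (fun w => F (b :: w)) (a :: u) v +
        (a - b)⁻¹ • (stuffleSum (fun w => F (a :: w)) u v -
          stuffleSum (fun w => F (b :: w)) u v) := by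
  rw [stuffleSum]

/-- Simultaneous induction on two words along the recursion of the stuffle product. -/
theorem word_induction {α : Type*} {P : List α → List α → Prop} (nil_left : ∀ v, P [] v)
    (nil_right : ∀ u, P u [])
    (cons_cons : ∀ a u b v, P u (b :: v) → P (a :: u) v → P u v → P (a :: u) (b :: v))
    (u v : List α) : P u v := by
  induction u generalizing v with
  | nil => exact nil_left v
  | cons a u ihu =>
    induction v with
    | nil => exact nil_right _
    | cons b v ihv => exact cons_cons a u b v (ihu _) ihv (ihu _)

theorem onShuffle_eq_shuffleSum (F : List K → K) (u v : List K) :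
    onShuffle F u v = shuffleSum F u v := by
  induction u, v using word_induction generalizing F with
  | nil_left v => simp [onShuffle]
  | nil_right u => cases u <;> simp [onShuffle]
  | cons_cons a u b v h1 h2 h3 => rw [onShuffle, shuffleSum_cons_cons, h1, h2]

theorem onStuffle_eq_stuffleSum (F : List K → K) (u v : List K) :
    onStuffle F u v = stuffleSum F u v := by
  induction u, v using word_induction generalizing F with
  | nil_left v => simp [onStuffle]
  | nil_right u => cases u <;> simp [onStuffle]
  | cons_cons a u b v h1 h2 h3 =>
    rw [onStuffle, stuffleSum_cons_cons, h1, h2, h3, h3, smul_eq_mul, div_eq_inv_mul]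

theorem map_shuffleSum {α : Type*} (f : V →+ W) (F : List α → V) (u v : List α) :
    f (shuffleSum F u v) = shuffleSum (fun w => f (F w)) u v := by
  induction u, v using word_induction generalizing F with
  | nil_left v => simp
  | nil_right u => simp
  | cons_cons a u b v h1 h2 h3 => simp only [shuffleSum_cons_cons, map_add, h1, h2]

theorem map_stuffleSum (f : V →ₗ[K] W) (F : List K → V) (u v : List K) :
    f (stuffleSum F u v) = stuffleSum (fun w => f (F w)) u v := by
  induction u, v using word_induction generalizing F with
  | nil_left v => simp
  | nil_right u => simp
  | cons_cons a u b v h1 h2 h3 =>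
    simp only [stuffleSum_cons_cons, map_add, map_sub, map_smul, h1, h2, h3]

theorem shuffleSum_congr {α : Type*} {F G : List α → V} {u v : List α}
    (h : ∀ w, w.Perm (u ++ v) → F w = G w) : shuffleSum F u v = shuffleSum G u v := by
  induction u, v using word_induction generalizing F G with
  | nil_left v => simpa using h v (by simp)
  | nil_right u => simpa using h u (by simp)
  | cons_cons a u b v h1 h2 h3 =>
    rw [shuffleSum_cons_cons, shuffleSum_cons_cons, h1, h2]
    · intro w hw
      exact h _ ((hw.cons b).trans List.perm_middle.symm)
    · intro w hw
      exact h _ (hw.cons a)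

/-- Merging terms drop letters, hence `Subperm` and not `Perm`. Distinctness of the letters
survives, which keeps the evaluations away from poles. -/
theorem stuffleSum_congr {F G : List K → V} {u v : List K}
    (h : ∀ w, w.Subperm (u ++ v) → F w = G w) : stuffleSum F u v = stuffleSum G u v := by
  induction u, v using word_induction generalizing F G with
  | nil_left v => simpa using h v (List.Subperm.refl _)
  | nil_right u => simpa using h u (by simpa using List.Subperm.refl _)
  | cons_cons a u b v h1 h2 h3 =>
    have mid : (b :: (a :: u ++ v)).Subperm (a :: u ++ b :: v) := List.perm_middle.symm.subperm
    have ha : (u ++ v).Subperm (u ++ b :: v) := ((List.sublist_cons_self b v).append_left u).subperm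
    have hb : (u ++ v).Subperm (a :: u ++ v) := (List.sublist_cons_self a (u ++ v)).subperm
    have fa : ∀ w, w.Subperm (u ++ b :: v) → F (a :: w) = G (a :: w) := fun w hw =>
      h _ ((List.subperm_cons a).2 hw)
    have fb : ∀ w, w.Subperm (a :: u ++ v) → F (b :: w) = G (b :: w) := fun w hw =>
      h _ (((List.subperm_cons b).2 hw).trans mid)
    rw [stuffleSum_cons_cons, stuffleSum_cons_cons, h1 fa, h2 fb, h3 fun w hw => fa w (hw.trans ha),
      h3 fun w hw => fb w (hw.trans hb)]

/-- Naturality under linear maps already contains additivity: apply it to `w ↦ (F w, G w)` and the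
maps `fst`, `snd`, `fst + snd`. -/
theorem stuffleSum_add (F G : List K → V) (u v : List K) :
    stuffleSum (fun w => F w + G w) u v = stuffleSum F u v + stuffleSum G u v := by
  have h := map_stuffleSum (LinearMap.fst K V V + LinearMap.snd K V V) (fun w => (F w, G w)) u v
  have h1 := map_stuffleSum (LinearMap.fst K V V) (fun w => (F w, G w)) u v
  have h2 := map_stuffleSum (LinearMap.snd K V V) (fun w => (F w, G w)) u v
  simp only [LinearMap.add_apply, LinearMap.fst_apply, LinearMap.snd_apply] at h h1 h2
  rw [← h, h1, h2]

theorem stuffleSum_smul (c : K) (F : List K → V) (u v : List K) :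
    stuffleSum (fun w => c • F w) u v = c • stuffleSum F u v := by
  simpa using (map_stuffleSum (c • (LinearMap.id : V →ₗ[K] V)) F u v).symm

theorem shuffleSum_add {α : Type*} (F G : List α → V) (u v : List α) :
    shuffleSum (fun w => F w + G w) u v = shuffleSum F u v + shuffleSum G u v := by
  have h := map_shuffleSum (AddMonoidHom.fst V V + AddMonoidHom.snd V V) (fun w => (F w, G w)) u v
  have h1 := map_shuffleSum (AddMonoidHom.fst V V) (fun w => (F w, G w)) u v
  have h2 := map_shuffleSum (AddMonoidHom.snd V V) (fun w => (F w, G w)) u v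
  simp only [AddMonoidHom.add_apply, AddMonoidHom.coe_fst, AddMonoidHom.coe_snd] at h h1 h2
  rw [← h, h1, h2]

theorem shuffleSum_const_mul {α : Type*} (c : K) (F : List α → K) (u v : List α) :
    shuffleSum (fun w => c * F w) u v = c * shuffleSum F u v :=
  (map_shuffleSum (AddMonoidHom.mulLeft c) F u v).symm

/-- The counit: `1` at the empty word and `0` elsewhere. -/
def counit (K : Type*) [Field K] {α : Type*} : List α → K
  | [] => 1
  | _ :: _ => 0

theorem stuffleSum_counit (u v : List K) :
    stuffleSum (counit K) u v = counit K u * counit K v := by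
  have key : ∀ u v : List K, stuffleSum (fun _ => (0 : K)) u v = 0 := fun u v => by
    simpa using (map_stuffleSum (0 : K →ₗ[K] K) (fun _ => (0 : K)) u v).symm
  cases u <;> cases v <;> simp [stuffleSum_cons_cons, counit, key]

theorem shuffleSum_counit {α : Type*} (u v : List α) :
    shuffleSum (counit K) u v = counit K u * counit K v := by
  have key : ∀ u v : List α, shuffleSum (fun _ => (0 : K)) u v = 0 := fun u v => by
    simpa using (map_shuffleSum (0 : K →+ K) (fun _ => (0 : K)) u v).symm
  cases u <;> cases v <;> simp [shuffleSum_cons_cons, counit, key]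

/-! ### Sums over vines as polynomials in the height -/

/-- The sum over all vines `v` with root `y` and grapes `w` of `t^{h(v)-1} φ(last grape) / x_v`,
as a polynomial in `t`. -/
def vineSum (φ : K → K) : K → List K → K[X]
  | _, [] => 0
  | y, a :: w => C (a - y)⁻¹ * (vineSum φ y w + X * vineSum φ a w + C (counit K w * φ a))

/-- All vines on a given word have the same last grape. -/
theorem vineSum_eq_mul_getLast (φ : K → K) (y : K) (w : List K) (hw : w ≠ []) :
    vineSum φ y w = C (φ (w.getLast hw)) * vineSum (fun _ => 1) y w := by
  induction w generalizing y with
  | nil => simp at hw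
  | cons a w ih =>
    cases w with
    | nil => simp [vineSum, counit]; ring
    | cons b w =>
      rw [vineSum, ih y (by simp), ih a (by simp), vineSum.eq_2 (w := b :: w), counit,
        List.getLast_cons_cons]
      simp only [zero_mul, C_0]
      ring

/-- Only `y = s` is needed in the end, but the recursion moves the root to a letter, so the
induction requires a free root and hence the correction term with `y - s`. -/
theorem stuffleSum_eval_vineSum (t s y : K) (u v : List K) (hd : (u ++ v).Nodup)
    (hs : s ∉ u ++ v) (hy : y ∉ u ++ v) :
    stuffleSum (fun w => (vineSum (fun a => (a - s)⁻¹) y w).eval t) u v =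
      (y - s) * (1 + t) * (vineSum (fun a => (a - s)⁻¹) y u).eval t *
          (vineSum (fun a => (a - s)⁻¹) y v).eval t +
        counit K u * (vineSum (fun a => (a - s)⁻¹) y v).eval t +
        counit K v * (vineSum (fun a => (a - s)⁻¹) y u).eval t := by
  set m : K → List K → K := fun y w => (vineSum (fun a => (a - s)⁻¹) y w).eval t with hm
  have m_nil : ∀ y, m y [] = 0 := fun y => by simp [hm, vineSum]
  have m_cons : ∀ y a w, m y (a :: w) =
      (a - y)⁻¹ * (m y w + t * m a w + counit K w * (a - s)⁻¹) := fun y a w => by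
    simp [hm, vineSum]
  have step : ∀ y a u v, stuffleSum (fun w => m y (a :: w)) u v =
      (a - y)⁻¹ * (stuffleSum (m y) u v + t * stuffleSum (m a) u v +
        counit K u * counit K v * (a - s)⁻¹) := fun y a u v => by
    have h : (fun w => m y (a :: w)) = fun w =>
        (a - y)⁻¹ • ((m y w + t • m a w) + (a - s)⁻¹ • counit K w) := by
      funext w
      rw [m_cons]
      simp only [smul_eq_mul]
      ring
    rw [h, stuffleSum_smul, stuffleSum_add, stuffleSum_add, stuffleSum_smul, stuffleSum_smul,
      stuffleSum_counit]
    simp only [smul_eq_mul]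
    ring
  change stuffleSum (m y) u v = (y - s) * (1 + t) * m y u * m y v + counit K u * m y v +
    counit K v * m y u
  induction u, v using word_induction generalizing y with
  | nil_left v => simp [m_nil, counit]
  | nil_right u => simp [m_nil, counit]
  | cons_cons a u b v h1 h2 h3 =>
    have hd' := hd
    simp only [List.cons_append, List.nodup_cons, List.nodup_append, List.mem_append,
      List.mem_cons, not_or, ne_eq] at hd hs hy
    obtain ⟨⟨hau, hab, hav⟩, hu, ⟨hbv, hv⟩, huv⟩ := hd
    have n1 : (u ++ b :: v).Nodup := (List.nodup_cons.1 hd').2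
    have n2 : (b :: (a :: u ++ v)).Nodup := (List.perm_middle.nodup_iff).1 hd'
    have n2' := (List.nodup_cons.1 n2).2
    have n3 : (u ++ v).Nodup := (List.nodup_cons.1 n2').2
    have hbu : b ∉ u := fun h => huv b h b (by simp) rfl
    rw [stuffleSum_cons_cons, step y a, step y b, step y a, step y b]
    rw [h1 y n1 (by simp; tauto) (by simp; tauto), h1 a n1 (by simp; tauto) (by simp; tauto),
      h2 y n2' (by simp; tauto) (by simp; tauto), h2 b n2' (by simp; tauto) (by simp; tauto),
      h3 y n3 (by simp; tauto) (by simp; tauto), h3 a n3 (by simp; tauto) (by simp; tauto),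
      h3 b n3 (by simp; tauto) (by simp; tauto)]
    have c1 : ∀ x (w : List K), counit K (x :: w) = 0 := fun _ _ => rfl
    simp only [m_cons, c1, smul_eq_mul]
    have e1 : a - y ≠ 0 := sub_ne_zero.2 (fun h => hy.1 h.symm)
    have e2 : b - y ≠ 0 := sub_ne_zero.2 (fun h => hy.2.2.1 h.symm)
    have e3 : a - s ≠ 0 := sub_ne_zero.2 (fun h => hs.1 h.symm)
    have e4 : b - s ≠ 0 := sub_ne_zero.2 (fun h => hs.2.2.1 h.symm)
    have e5 : a - b ≠ 0 := sub_ne_zero.2 hab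
    have e6 : b - a ≠ 0 := sub_ne_zero.2 (Ne.symm hab)
    have e7 : (b - a)⁻¹ = - (a - b)⁻¹ := by rw [← inv_neg, neg_sub]
    rw [e7]
    -- What remains is a rational identity in `y`, `s`, `t`, `a`, `b` and the values for the three
    -- roots `y`, `a`, `b`, which may be treated as independent.
    generalize m y u = yu, m a u = xu, m b u = zu, m y v = yv, m a v = xv, m b v = zv,
      counit K u = e, counit K v = f
    clear step m_cons m_nil h1 h2 h3
    clear_value m
    field_simp
    ring

theorem stuffleSum_vineSum [Infinite K] (s : K) (u v : List K) (hu : u ≠ []) (hv : v ≠ [])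
    (hd : (u ++ v).Nodup) (hs : s ∉ u ++ v) :
    stuffleSum (vineSum (fun a => (a - s)⁻¹) s) u v = 0 := by
  refine Polynomial.funext fun t => ?_
  have h := stuffleSum_eval_vineSum t s s u v hd hs hs
  have h' := map_stuffleSum (Polynomial.leval t : K[X] →ₗ[K] K)
    (vineSum (fun a => (a - s)⁻¹) s) u v
  simp only [Polynomial.leval_apply] at h'
  rw [h', h]
  obtain ⟨a, u, rfl⟩ := List.exists_cons_of_ne_nil hu
  obtain ⟨b, v, rfl⟩ := List.exists_cons_of_ne_nil hv
  simp [counit]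

end Words

/-! ### Deconcatenation and shuffles -/

section Shuffle

variable {K : Type*} [Field K]

/-- The convolution product for deconcatenation of words. -/
def conv {α : Type*} (A B : List α → K) (w : List α) : K :=
  ∑ i ∈ Finset.range (w.length + 1), A (w.take i) * B (w.drop i)

theorem conv_nil {α : Type*} (A B : List α → K) : conv A B [] = A [] * B [] := by
  simp [conv]

theorem conv_cons {α : Type*} (A B : List α → K) (a : α) (w : List α) :
    conv A B (a :: w) = A [] * B (a :: w) + conv (fun w => A (a :: w)) B w := by
  rw [conv, List.length_cons, Finset.sum_range_succ', add_comm]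
  simp [conv]

theorem conv_const_mul {α : Type*} (c : K) (A B : List α → K) (w : List α) :
    conv (fun w => c * A w) B w = c * conv A B w := by
  simp only [conv, Finset.mul_sum, mul_assoc]

/-- Deconcatenation is a homomorphism for the shuffle product. -/
theorem shuffleSum_conv {α : Type*} (A B : List α → K) (u v : List α) :
    shuffleSum (conv A B) u v = ∑ i ∈ Finset.range (u.length + 1),
      ∑ j ∈ Finset.range (v.length + 1),
        shuffleSum A (u.take i) (v.take j) * shuffleSum B (u.drop i) (v.drop j) := by
  induction u, v using word_induction generalizing A with
  | nil_left v => simp [conv]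
  | nil_right u => simp [conv]
  | cons_cons a u b v h1 h2 h3 =>
    have ha : (fun w => conv A B (a :: w)) =
        fun w => A [] * B (a :: w) + conv (fun w => A (a :: w)) B w :=
      funext fun w => conv_cons A B a w
    have hb : (fun w => conv A B (b :: w)) =
        fun w => A [] * B (b :: w) + conv (fun w => A (b :: w)) B w :=
      funext fun w => conv_cons A B b w
    rw [shuffleSum_cons_cons, ha, hb, shuffleSum_add, shuffleSum_add, shuffleSum_const_mul,
      shuffleSum_const_mul, h1, h2]
    simp only [List.length_cons]
    -- The cuts with `i = 0` or `j = 0` are split off; in the others both left pieces are nonempty,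
    -- so their shuffle can be expanded at the first letters.
    rw [Finset.sum_range_succ' _ (u.length + 1)]
    simp only [Finset.sum_range_succ' _ (v.length + 1), List.take_succ_cons, List.drop_succ_cons,
      List.take_zero, List.drop_zero, shuffleSum_nil_left, shuffleSum_nil_right]
    rw [Finset.sum_range_succ' _ (u.length + 1)]
    simp only [List.take_succ_cons, List.drop_succ_cons, List.take_zero, List.drop_zero,
      shuffleSum_nil_left, shuffleSum_cons_cons B a b u v,
      fun i j => shuffleSum_cons_cons A a b (u.take i) (v.take j), add_mul, mul_add,
      Finset.sum_add_distrib]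
    ring

theorem shuffleSum_conv_of_mul {α : Type*} (A B : List α → K) (S : Set α)
    (hA : ∀ u v : List α, (∀ x ∈ u, x ∈ S) → (∀ x ∈ v, x ∈ S) → shuffleSum A u v = A u * A v)
    (hB : ∀ u v : List α, (∀ x ∈ u, x ∈ S) → (∀ x ∈ v, x ∈ S) → shuffleSum B u v = B u * B v)
    (u v : List α) (hu : ∀ x ∈ u, x ∈ S) (hv : ∀ x ∈ v, x ∈ S) :
    shuffleSum (conv A B) u v = conv A B u * conv A B v := by
  rw [shuffleSum_conv, conv, conv, Finset.sum_mul_sum]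
  refine Finset.sum_congr rfl fun i _ => Finset.sum_congr rfl fun j _ => ?_
  rw [hA _ _ (fun x hx => hu x (List.mem_of_mem_take hx)) fun x hx => hv x (List.mem_of_mem_take hx),
    hB _ _ (fun x hx => hu x (List.mem_of_mem_drop hx)) fun x hx => hv x (List.mem_of_mem_drop hx)]
  ring

/-- Recursion at the last letters suits `invPartialSums`, whose last factor depends only on the sum
of the word. -/
theorem shuffleSum_append_singleton {α V : Type*} [AddCommGroup V] (F : List α → V) (a b : α)
    (u v : List α) :
    shuffleSum F (u ++ [a]) (v ++ [b]) = shuffleSum (fun w => F (w ++ [a])) u (v ++ [b]) +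
      shuffleSum (fun w => F (w ++ [b])) (u ++ [a]) v := by
  have nil_left : ∀ (v : List α) (F : List α → V), shuffleSum F [a] (v ++ [b]) =
      F (v ++ [b] ++ [a]) + shuffleSum (fun w => F (w ++ [b])) [a] v := fun v => by
    induction v with
    | nil => intro F; simp [shuffleSum_cons_cons, add_comm]
    | cons c v ih =>
      intro F
      rw [List.cons_append, shuffleSum_cons_cons, ih, shuffleSum_cons_cons]
      simp only [shuffleSum_nil_left, List.cons_append]
      abel
  have nil_right : ∀ (u : List α) (F : List α → V), shuffleSum F (u ++ [a]) [b] =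
      shuffleSum (fun w => F (w ++ [a])) u [b] + F (u ++ [a] ++ [b]) := fun u => by
    induction u with
    | nil => intro F; simp [shuffleSum_cons_cons, add_comm]
    | cons c u ih =>
      intro F
      rw [List.cons_append, shuffleSum_cons_cons, ih, shuffleSum_cons_cons]
      simp only [shuffleSum_nil_right, List.cons_append]
      abel
  induction u, v using word_induction generalizing F with
  | nil_left v => simpa using nil_left v F
  | nil_right u => simpa using nil_right u F
  | cons_cons c u d v h1 h2 h3 =>
    have h1' := h1 (fun w => F (c :: w))
    have h2' := h2 (fun w => F (d :: w))
    simp only [List.cons_append] at h1' h2' ⊢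
    rw [shuffleSum_cons_cons, h1', h2', shuffleSum_cons_cons, shuffleSum_cons_cons]
    simp only [List.cons_append]
    abel

/-- `1 / ((p + a_1) (p + a_1 + a_2) ⋯ (p + a_1 + ⋯ + a_r))`. -/
def invPartialSums : K → List K → K
  | _, [] => 1
  | p, a :: w => (p + a)⁻¹ * invPartialSums (p + a) w

theorem invPartialSums_append_singleton (p a : K) (w : List K) :
    invPartialSums p (w ++ [a]) = invPartialSums p w * (p + w.sum + a)⁻¹ := by
  induction w generalizing p with
  | nil => simp [invPartialSums]
  | cons b w ih =>
    rw [List.cons_append, invPartialSums, ih, invPartialSums, List.sum_cons]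
    simp only [mul_assoc, add_assoc]

theorem sum_mem_of_ne_nil (S : AddSubsemigroup K) (w : List K) (hw : ∀ x ∈ w, x ∈ S)
    (hne : w ≠ []) : w.sum ∈ S := by
  induction w with
  | nil => simp at hne
  | cons a w ih =>
    rw [List.sum_cons]
    by_cases h : w = []
    · simpa [h] using hw a (by simp)
    · exact S.add_mem (hw a (by simp)) (ih (fun x hx => hw x (by simp [hx])) h)

/-- With `P`, `Q` the sums of the two words, the induction step is `1/(PQ) = (1/P + 1/Q)/(P + Q)`.
Letters in an additive semigroup without `0` have no vanishing sums. -/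
theorem shuffleSum_invPartialSums (S : AddSubsemigroup K) (hS : (0 : K) ∉ S) (u v : List K)
    (hu : ∀ x ∈ u, x ∈ S) (hv : ∀ x ∈ v, x ∈ S) :
    shuffleSum (invPartialSums 0) u v = invPartialSums 0 u * invPartialSums 0 v := by
  -- Reversing makes `word_induction` peel off last letters.
  rw [← u.reverse_reverse, ← v.reverse_reverse]
  rw [← u.reverse_reverse] at hu
  rw [← v.reverse_reverse] at hv
  generalize u.reverse = u at *
  generalize v.reverse = v at *
  induction u, v using word_induction with
  | nil_left v => simp [invPartialSums]
  | nil_right u => simp [invPartialSums]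
  | cons_cons a u b v h1 h2 h3 =>
    simp only [List.reverse_cons] at *
    generalize u.reverse = u at *
    generalize v.reverse = v at *
    have hu' : ∀ x ∈ u, x ∈ S := fun x hx => hu x (by simp [hx])
    have hv' : ∀ x ∈ v, x ∈ S := fun x hx => hv x (by simp [hx])
    have nz : ∀ w : List K, (∀ x ∈ w, x ∈ S) → w ≠ [] → w.sum ≠ 0 := fun w hw hne h =>
      hS (h ▸ sum_mem_of_ne_nil S w hw hne)
    have n1 := nz (u ++ [a]) hu (by simp)
    have n2 := nz (v ++ [b]) hv (by simp)
    have n3 := nz (u ++ [a] ++ (v ++ [b])) (fun x hx => (List.mem_append.1 hx).elim (hu x) (hv x))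
      (by simp)
    rw [shuffleSum_append_singleton]
    have e1 : shuffleSum (fun w => invPartialSums 0 (w ++ [a])) u (v ++ [b]) =
        (u.sum + a + (v.sum + b))⁻¹ * shuffleSum (invPartialSums 0) u (v ++ [b]) := by
      rw [← shuffleSum_const_mul]
      refine shuffleSum_congr fun w hw => ?_
      rw [invPartialSums_append_singleton, mul_comm, hw.sum_eq]
      simp only [List.sum_append, List.sum_singleton]
      congr 2
      ring
    have e2 : shuffleSum (fun w => invPartialSums 0 (w ++ [b])) (u ++ [a]) v =
        (u.sum + a + (v.sum + b))⁻¹ * shuffleSum (invPartialSums 0) (u ++ [a]) v := by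
      rw [← shuffleSum_const_mul]
      refine shuffleSum_congr fun w hw => ?_
      rw [invPartialSums_append_singleton, mul_comm, hw.sum_eq]
      simp only [List.sum_append, List.sum_singleton]
      congr 2
      ring
    rw [e1, e2, h1 hu' hv, h2 hu hv', invPartialSums_append_singleton,
      invPartialSums_append_singleton]
    simp only [List.sum_append, List.sum_singleton] at n1 n2 n3
    rw [zero_add, zero_add]
    generalize u.sum + a = p at *
    generalize v.sum + b = q at *
    field_simp

/-! ### Powers of a character and their logarithm -/

/-- The partial sums `p + a_1, p + a_1 + a_2, …` of a word `a_1 a_2 …`. -/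
def partialSums : K → List K → List K
  | _, [] => []
  | p, a :: w => (p + a) :: partialSums (p + a) w

theorem tail_scanl_eq_partialSums (p : K) (w : List K) :
    (w.scanl (· + ·) p).tail = partialSums p w := by
  induction w generalizing p with
  | nil => simp [partialSums]
  | cons a w ih =>
    rw [partialSums, ← ih]
    cases w <;> simp

theorem counit_partialSums (p : K) (w : List K) :
    counit K (partialSums p w) = counit K w := by
  cases w <;> rfl

/-- With constant `φ`, only differences of coordinates enter, so translating by `y` changes nothing.
-/
theorem vineSum_partialSums (y p : K) (w : List K) :
    vineSum (fun _ => 1) y (partialSums p w) = vineSum (fun _ => 1) 0 (partialSums (p - y) w) := by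
  induction w generalizing y p with
  | nil => rfl
  | cons a w ih =>
    rw [partialSums, partialSums, vineSum, vineSum, ih y, ih (p + a), ih (p - y + a)]
    simp only [counit_partialSums, sub_self, sub_zero]
    rw [show p + a - y = p - y + a by ring]

/-- By translation, opening a new bunch restarts the partial sums at `0`: cutting a vine between
bunches becomes deconcatenation. -/
theorem vineSum_partialSums_cons (p a : K) (w : List K) :
    vineSum (fun _ => 1) 0 (partialSums p (a :: w)) =
      C (p + a)⁻¹ * (vineSum (fun _ => 1) 0 (partialSums (p + a) w) +
        X * vineSum (fun _ => 1) 0 (partialSums 0 w) + C (counit K w)) := by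
  rw [partialSums, vineSum, vineSum_partialSums (p + a), counit_partialSums]
  simp

/-- The linear functional on `K[t]` with `t ^ k ↦ c k`. -/
def momentMap (V : Type*) [AddCommGroup V] [Module K V] (c : ℕ → V) : K[X] →ₗ[K] V :=
  (Polynomial.basisMonomials K).constr K c

/-! ### Linear functionals on polynomials given by their values on monomials -/

section momentMap

variable {V W : Type*} [AddCommGroup V] [Module K V] [AddCommGroup W] [Module K W]

@[simp] theorem momentMap_monomial (c : ℕ → V) (k : ℕ) :
    momentMap V c (monomial k (1 : K)) = c k := by
  have := (Polynomial.basisMonomials K).constr_basis K c k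
  simpa [momentMap] using this

theorem momentMap_C_mul (c : ℕ → V) (a : K) (f : K[X]) :
    momentMap V c (C a * f) = a • momentMap V c f := by
  rw [← smul_eq_C_mul, map_smul]

theorem momentMap_C (c : ℕ → V) (a : K) : momentMap V c (C a) = a • c 0 := by
  rw [← mul_one (C a), momentMap_C_mul, ← monomial_zero_one, momentMap_monomial]

theorem momentMap_X_mul (c : ℕ → V) (f : K[X]) :
    momentMap V c (X * f) = momentMap V (fun k => c (k + 1)) f := by
  have : momentMap V c ∘ₗ LinearMap.mulLeft K X = momentMap V (fun k => c (k + 1)) := by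
    refine (Polynomial.basisMonomials K).ext fun k => ?_
    simp [X_mul_monomial]
  simpa using LinearMap.congr_fun this f

theorem momentMap_add (c d : ℕ → V) (f : K[X]) :
    momentMap V (fun k => c k + d k) f = momentMap V c f + momentMap V d f := by
  have : momentMap (K := K) V (fun k => c k + d k) = momentMap V c + momentMap V d := by
    refine (Polynomial.basisMonomials K).ext fun k => ?_
    simp
  simpa using LinearMap.congr_fun this f

theorem momentMap_comp (g : V →ₗ[K] W) (c : ℕ → V) (f : K[X]) :
    g (momentMap V c f) = momentMap W (fun k => g (c k)) f := by
  have : g ∘ₗ momentMap (K := K) V c = momentMap W (fun k => g (c k)) := by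
    refine (Polynomial.basisMonomials K).ext fun k => ?_
    simp
  simpa using LinearMap.congr_fun this f

end momentMap

/-- The `n`-th convolution power of `invPartialSums 0`, expressed through vines. -/
def charPow (n : ℕ) (w : List K) : K :=
  counit K w +
    momentMap K (fun k => (n.choose (k + 1) : K)) (vineSum (fun _ => 1) 0 (partialSums 0 w))

/-- An empty first factor contributes `charPow n w`. A nonempty one is the first bunch of a vine,
whose `k` further bunches are distributed over the `n` other factors in `n.choose k` ways. The
offset `p` records the letters already read in the induction. -/
theorem conv_invPartialSums_charPow (n : ℕ) (p : K) (w : List K) :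
    conv (invPartialSums p) (charPow n) w = charPow n w +
      momentMap K (fun k => (n.choose k : K)) (vineSum (fun _ => 1) 0 (partialSums p w)) := by
  induction w generalizing p with
  | nil => simp [conv_nil, invPartialSums, partialSums, vineSum]
  | cons a w ih =>
    rw [conv_cons]
    simp only [invPartialSums]
    rw [conv_const_mul, ih, vineSum_partialSums_cons, momentMap_C_mul, map_add, map_add,
      momentMap_X_mul, momentMap_C, charPow.eq_1 n w]
    simp only [smul_eq_mul, Nat.choose_zero_right, Nat.cast_one]
    ring

/-- Pascal's rule applied to the case `p = 0`. -/
theorem charPow_succ (n : ℕ) (w : List K) :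
    charPow (n + 1) w = conv (invPartialSums 0) (charPow n) w := by
  rw [conv_invPartialSums_charPow, charPow, charPow, add_assoc, ← momentMap_add]
  simp only [Nat.choose_succ_succ, Nat.cast_add, add_comm]

theorem shuffleSum_charPow (S : AddSubsemigroup K) (hS : (0 : K) ∉ S) (n : ℕ) (u v : List K)
    (hu : ∀ x ∈ u, x ∈ S) (hv : ∀ x ∈ v, x ∈ S) :
    shuffleSum (charPow n) u v = charPow n u * charPow n v := by
  induction n generalizing u v with
  | zero =>
    have : (charPow 0 : List K → K) = counit K := funext fun w => by
      have h := momentMap_comp (0 : K →ₗ[K] K) (fun _ => (0 : K))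
        (vineSum (fun _ => 1) 0 (partialSums 0 w))
      simp only [LinearMap.zero_apply] at h
      simp [charPow, ← h]
    rw [this, shuffleSum_counit]
  | succ n ih =>
    have : (charPow (n + 1) : List K → K) = conv (invPartialSums 0) (charPow n) :=
      funext (charPow_succ n)
    rw [this]
    exact shuffleSum_conv_of_mul _ _ S (shuffleSum_invPartialSums S hS)
      (fun u v hu hv => ih u v hu hv) u v hu hv

theorem coeff_one_descPochhammer (k : ℕ) :
    (descPochhammer K (k + 1)).coeff 1 = (-1) ^ k * (k.factorial : K) := by
  induction k with
  | zero => simp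
  | succ k ih =>
    rw [descPochhammer_succ_right, mul_sub, coeff_sub, coeff_mul_X, ← C_eq_natCast, coeff_mul_C, ih]
    have : (descPochhammer K (k + 1)).coeff 0 = 0 := by
      rw [coeff_zero_eq_eval_zero]; simp
    rw [this, Nat.factorial_succ]
    push_cast
    ring

variable [CharZero K]

/-- The polynomial in `n` which interpolates `charPow n`. -/
def powPoly : K[X] →ₗ[K] K[X] :=
  momentMap K[X] fun k => C ((k + 1).factorial : K)⁻¹ * descPochhammer K (k + 1)

theorem eval_powPoly (n : ℕ) (f : K[X]) :
    (powPoly f).eval (n : K) = momentMap K (fun k => (n.choose (k + 1) : K)) f := by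
  have h := momentMap_comp (Polynomial.leval (n : K) : K[X] →ₗ[K] K)
    (fun k => C ((k + 1).factorial : K)⁻¹ * descPochhammer K (k + 1)) f
  rw [Polynomial.leval_apply] at h
  rw [powPoly, h]
  congr 2
  funext k
  rw [Polynomial.leval_apply, eval_mul, eval_C, descPochhammer_eval_eq_descFactorial,
    Nat.descFactorial_eq_factorial_mul_choose]
  have : ((k + 1).factorial : K) ≠ 0 := by exact_mod_cast (k + 1).factorial_ne_zero
  push_cast
  field_simp

theorem coeff_zero_powPoly (f : K[X]) : (powPoly f).coeff 0 = 0 := by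
  rw [coeff_zero_eq_eval_zero]
  have h := eval_powPoly 0 f
  have h' := momentMap_comp (0 : K →ₗ[K] K) (fun _ => (0 : K)) f
  simp only [LinearMap.zero_apply] at h'
  simpa [← h'] using h

/-- The linear coefficient of the binomial `n.choose (k + 1)` in `n` is `(-1)^k / (k + 1)`, the
coefficient of the logarithm series. -/
theorem coeff_one_powPoly (f : K[X]) :
    (powPoly f).coeff 1 = momentMap K (fun k => (-1) ^ k / ((k : K) + 1)) f := by
  have h := momentMap_comp (Polynomial.lcoeff K 1)
    (fun k => C ((k + 1).factorial : K)⁻¹ * descPochhammer K (k + 1)) f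
  rw [Polynomial.lcoeff_apply] at h
  rw [powPoly, h]
  congr 2
  funext k
  rw [Polynomial.lcoeff_apply, coeff_C_mul, coeff_one_descPochhammer, Nat.factorial_succ]
  have h1 : (k.factorial : K) ≠ 0 := by exact_mod_cast k.factorial_ne_zero
  have h2 : (k : K) + 1 ≠ 0 := by exact_mod_cast k.succ_ne_zero
  push_cast
  field_simp

/-- The logarithm of a character vanishes on shuffle products. -/
theorem shuffleSum_log (S : AddSubsemigroup K) (hS : (0 : K) ∉ S) (u v : List K)
    (hu : ∀ x ∈ u, x ∈ S) (hv : ∀ x ∈ v, x ∈ S) (hu0 : u ≠ []) (hv0 : v ≠ []) :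
    shuffleSum (fun w => momentMap K (fun k => (-1) ^ k / ((k : K) + 1))
      (vineSum (fun _ => 1) 0 (partialSums 0 w))) u v = 0 := by
  set F : List K → K[X] := fun w => vineSum (fun _ => 1) 0 (partialSums 0 w) with hF
  -- Two polynomials in `n` that agree at every natural number, since each `charPow n` is
  -- multiplicative on shuffles.
  have key : powPoly (shuffleSum F u v) = powPoly (F u) * powPoly (F v) := by
    refine Polynomial.eq_of_infinite_eval_eq _ _
      ((Set.infinite_range_of_injective (Nat.cast_injective (R := K))).mono ?_)
    rintro _ ⟨n, rfl⟩
    have h := shuffleSum_charPow S hS n u v hu hv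
    have e : ∀ w : List K, w ≠ [] → charPow n w = (powPoly (F w)).eval (n : K) := fun w hw => by
      obtain ⟨a, w, rfl⟩ := List.exists_cons_of_ne_nil hw
      rw [eval_powPoly, charPow, counit, zero_add]
    rw [e u hu0, e v hv0, shuffleSum_congr (G := fun w => (powPoly (F w)).eval (n : K))
      (fun w hw => e w fun h0 => hu0 (List.append_eq_nil_iff.1 (h0 ▸ hw).symm.eq_nil).1)] at h
    simp only [Set.mem_ofPred_eq, eval_mul]
    rw [← h]
    exact map_shuffleSum ((Polynomial.leval (n : K)).comp powPoly).toAddMonoidHom F u v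
  have h := map_shuffleSum ((Polynomial.lcoeff K 1).comp powPoly).toAddMonoidHom F u v
  simp only [LinearMap.toAddMonoidHom_coe, LinearMap.comp_apply, Polynomial.lcoeff_apply,
    coeff_one_powPoly] at h
  -- Both factors have zero constant term, so their product has no linear term.
  rw [← h, ← coeff_one_powPoly, key, mul_coeff_one, coeff_zero_powPoly, coeff_zero_powPoly]
  simp

end Shuffle

/-! ### Compositions and vines -/

/-- Enlarges the first block of a composition by one. -/
def enlargeHead : List ℕ → List ℕ
  | [] => []
  | k :: l => (k + 1) :: l

/-- The list of all compositions of `n`, given by their blocks. -/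
def compositionBlocks : ℕ → List (List ℕ)
  | 0 => [[]]
  | 1 => [[1]]
  | n + 2 => (compositionBlocks (n + 1)).map (1 :: ·) ++ (compositionBlocks (n + 1)).map enlargeHead

theorem mem_compositionBlocks {n : ℕ} {l : List ℕ} :
    l ∈ compositionBlocks n ↔ (∀ k ∈ l, 0 < k) ∧ l.sum = n := by
  have pos_nil : ∀ {l : List ℕ}, (∀ k ∈ l, 0 < k) → l.sum = 0 → l = [] := fun {l} hl h => by
    cases l with
    | nil => rfl
    | cons k l =>
      have := hl k (by simp)
      simp at h
      omega
  induction n using compositionBlocks.induct generalizing l with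
  | case1 =>
    simp only [compositionBlocks, List.mem_singleton]
    exact ⟨by rintro rfl; simp, fun h => pos_nil h.1 h.2⟩
  | case2 =>
    simp only [compositionBlocks, List.mem_singleton]
    refine ⟨by rintro rfl; simp, fun ⟨h, hs⟩ => ?_⟩
    cases l with
    | nil => simp at hs
    | cons k l =>
      have := h k (by simp)
      simp only [List.sum_cons] at hs
      rw [pos_nil (l := l) (fun x hx => h x (by simp [hx])) (by omega)]
      simp; omega
  | case3 n ih =>
    simp only [compositionBlocks, List.mem_append, List.mem_map, ih]
    constructor
    · rintro (⟨c, ⟨h, hs⟩, rfl⟩ | ⟨c, ⟨h, hs⟩, rfl⟩)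
      · refine ⟨by simpa using h, ?_⟩
        simp only [List.sum_cons]
        omega
      · cases c with
        | nil => simp at hs
        | cons k c =>
          simp only [List.mem_cons, forall_eq_or_imp, List.sum_cons, enlargeHead] at *
          exact ⟨⟨by omega, h.2⟩, by omega⟩
    · rintro ⟨h, hs⟩
      match l, h, hs with
      | [], h, hs => simp at hs
      | 0 :: l, h, hs => simp at h
      | 1 :: l, h, hs =>
        refine Or.inl ⟨l, ⟨fun x hx => h x (by simp [hx]), ?_⟩, rfl⟩
        simp only [List.sum_cons] at hs
        omega
      | (k + 2) :: l, h, hs =>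
        refine Or.inr ⟨(k + 1) :: l, ⟨?_, ?_⟩, rfl⟩
        · simp only [List.mem_cons, forall_eq_or_imp] at *
          exact ⟨by omega, h.2⟩
        · simp only [List.sum_cons] at *
          omega

theorem nodup_compositionBlocks (n : ℕ) : (compositionBlocks n).Nodup := by
  induction n using compositionBlocks.induct with
  | case1 => simp [compositionBlocks]
  | case2 => simp [compositionBlocks]
  | case3 n ih =>
    rw [compositionBlocks, List.nodup_append]
    refine ⟨ih.map fun a b h => by simpa using h, ih.map fun a b h => ?_, ?_⟩
    · match a, b, h with
      | [], [], _ => rfl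
      | k :: l, k' :: l', h => simpa [enlargeHead] using h
    · intro a ha b hb hab
      obtain ⟨c, hc, rfl⟩ := List.mem_map.1 ha
      obtain ⟨e, he, rfl⟩ := List.mem_map.1 hb
      cases e with
      | nil => simp [enlargeHead] at hab
      | cons k e =>
        have := (mem_compositionBlocks.1 he).1 k (by simp)
        simp only [enlargeHead, List.cons.injEq] at hab
        omega

theorem sum_composition_eq {M : Type*} [AddCommMonoid M] (n : ℕ) (f : List ℕ → M) :
    ∑ c : Composition n, f c.blocks = ((compositionBlocks n).map f).sum := by
  rw [← List.sum_toFinset _ (nodup_compositionBlocks n)]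
  refine Finset.sum_bij (fun c _ => c.blocks) (fun c _ => ?_) (fun c _ e _ h => Composition.ext h)
    (fun l hl => ?_) (fun c _ => rfl)
  · exact List.mem_toFinset.2 (mem_compositionBlocks.2 ⟨fun k hk => c.blocks_pos hk, c.blocks_sum⟩)
  · have h := mem_compositionBlocks.1 (List.mem_toFinset.1 hl)
    exact ⟨⟨l, fun {k} hk => h.1 k hk, h.2⟩, Finset.mem_univ _, rfl⟩

/-! ### Edge sets of vines -/

theorem le_fst_of_mem_graftEdges {l : List ℕ} {i : ℕ} {e : ℕ × ℕ} (he : e ∈ graftEdges i l) :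
    i ≤ e.1 := by
  induction l generalizing i with
  | nil => simp [graftEdges] at he
  | cons n l ih =>
    rw [graftEdges, Finset.mem_union] at he
    rcases he with he | he
    · obtain ⟨j, _, rfl⟩ := Finset.mem_image.1 he
      exact le_rfl
    · have := ih he
      omega

theorem disjoint_bunchEdges_graftEdges (i n : ℕ) (hn : 0 < n) (l : List ℕ) :
    Disjoint (bunchEdges i n) (graftEdges (i + n) l) := by
  rw [Finset.disjoint_left]
  intro e he he'
  obtain ⟨j, _, rfl⟩ := Finset.mem_image.1 he
  have := le_fst_of_mem_graftEdges he'
  simp only at this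
  omega

theorem lt_and_le_of_mem_graftEdges {l : List ℕ} {i : ℕ} {e : ℕ × ℕ} (he : e ∈ graftEdges i l) :
    e.1 < e.2 ∧ e.2 ≤ i + l.sum := by
  induction l generalizing i with
  | nil => simp [graftEdges] at he
  | cons n l ih =>
    rw [graftEdges, Finset.mem_union] at he
    rw [List.sum_cons]
    rcases he with he | he
    · obtain ⟨j, hj, rfl⟩ := Finset.mem_image.1 he
      rw [Finset.mem_Icc] at hj
      simp only
      omega
    · have := ih he
      omega

theorem lt_and_le_of_mem_edges {n : ℕ} {v : Vine n} {e : ℕ × ℕ} (he : e ∈ v.edges) :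
    e.1 < e.2 ∧ e.2 ≤ n := by
  have h := lt_and_le_of_mem_graftEdges he
  rwa [Composition.blocks_sum, zero_add] at h

theorem card_graftEdges (l : List ℕ) (hl : ∀ k ∈ l, 0 < k) (i : ℕ) :
    (graftEdges i l).card = l.sum := by
  induction l generalizing i with
  | nil => rfl
  | cons n l ih =>
    rw [graftEdges, Finset.card_union_of_disjoint
      (disjoint_bunchEdges_graftEdges i n (hl n (by simp)) l), ih fun k hk => hl k (by simp [hk]),
      bunchEdges, Finset.card_image_of_injective _ fun a b h => (Prod.ext_iff.1 h).2]
    simp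

theorem card_edges {n : ℕ} (v : Vine n) : v.edges.card = n := by
  rw [Vine.edges, card_graftEdges _ fun k hk => v.blocks_pos hk, v.blocks_sum]

/-! ### Vine denominators and the recursion on the first grape -/

section Field

variable {K : Type*} [Field K]

/-- The product of the differences of `c` along the edges of the vine with blocks `l`, whose root
has value `y` and whose first grape has label `i + 1`. -/
def graftProd (c : ℕ → K) : K → ℕ → List ℕ → K
  | _, _, [] => 1
  | y, i, n :: l => (∏ j ∈ Finset.range n, (c (i + j + 1) - y)) * graftProd c (c (i + n)) (i + n) l

theorem prod_graftEdges (c : ℕ → K) (l : List ℕ) (hl : ∀ k ∈ l, 0 < k) (i : ℕ) :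
    ∏ e ∈ graftEdges i l, (c e.2 - c e.1) = graftProd c (c i) i l := by
  induction l generalizing i with
  | nil => rfl
  | cons n l ih =>
    rw [graftEdges, Finset.prod_union (disjoint_bunchEdges_graftEdges i n (hl n (by simp)) l),
      ih fun k hk => hl k (by simp [hk]), graftProd, bunchEdges,
      Finset.prod_image fun a _ b _ h => (Prod.ext_iff.1 h).2,
      ← Finset.Ico_add_one_right_eq_Icc, Finset.prod_Ico_eq_prod_range]
    congr 1
    refine Finset.prod_congr (by congr 1; omega) fun j _ => ?_
    simp only [add_right_comm i 1 j]

theorem graftProd_one_cons (c : ℕ → K) (y : K) (i : ℕ) (l : List ℕ) :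
    graftProd c y i (1 :: l) = (c (i + 1) - y) * graftProd c (c (i + 1)) (i + 1) l := by
  simp [graftProd]

theorem graftProd_enlargeHead (c : ℕ → K) (y : K) (i : ℕ) (l : List ℕ) (hl : l ≠ []) :
    graftProd c y i (enlargeHead l) = (c (i + 1) - y) * graftProd c y (i + 1) l := by
  cases l with
  | nil => exact absurd rfl hl
  | cons n l =>
    rw [enlargeHead, graftProd, graftProd, Finset.prod_range_succ', add_zero,
      mul_comm (∏ _ ∈ _, _), mul_assoc]
    simp only [add_assoc, add_comm 1]

/-- The word `c_{i+1} ⋯ c_{i+n}`. -/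
def segment {L : Type*} (c : ℕ → L) (i n : ℕ) : List L := (List.range n).map fun j => c (i + j + 1)

theorem segment_succ {L : Type*} (c : ℕ → L) (i n : ℕ) :
    segment c i (n + 1) = c (i + 1) :: segment c (i + 1) n := by
  simp only [segment, List.range_succ_eq_map, List.map_cons, List.map_map, add_zero]
  congr 2
  funext j
  simp only [Function.comp, Nat.succ_eq_add_one]
  congr 1
  omega

/-- A first block `1` moves the root to the first grape and adds one to the height, giving the `X`
term of `vineSum`; an enlarged first block keeps root and height, giving the other term. -/
theorem sum_compositionBlocks_eq_vineSum (φ : K → K) (c : ℕ → K) (n : ℕ) (y : K) (i : ℕ) :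
    ((compositionBlocks (n + 1)).map fun l =>
      C ((graftProd c y i l)⁻¹ * φ (c (i + (n + 1)))) * X ^ (l.length - 1)).sum =
      vineSum φ y (segment c i (n + 1)) := by
  induction n generalizing y i with
  | zero => simp [compositionBlocks, segment, vineSum, counit, graftProd]
  | succ n ih =>
    have len : ∀ l ∈ compositionBlocks (n + 1), l ≠ [] := fun l hl h => by
      have := (mem_compositionBlocks.1 hl).2
      simp [h] at this
    have e : i + (n + 1 + 1) = i + 1 + (n + 1) := by omega
    have h1 : (compositionBlocks (n + 1)).map ((fun l : List ℕ =>
        C ((graftProd c y i l)⁻¹ * φ (c (i + (n + 1 + 1)))) * X ^ (l.length - 1)) ∘ (1 :: ·)) =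
        (compositionBlocks (n + 1)).map fun l => C (c (i + 1) - y)⁻¹ * X *
          (C ((graftProd c (c (i + 1)) (i + 1) l)⁻¹ * φ (c (i + 1 + (n + 1)))) *
            X ^ (l.length - 1)) := by
      refine List.map_congr_left fun l hl => ?_
      obtain ⟨k, l, rfl⟩ := List.exists_cons_of_ne_nil (len l hl)
      simp only [Function.comp, graftProd_one_cons, mul_inv, C_mul, List.length_cons, e,
        Nat.add_sub_cancel, pow_succ]
      ring
    have h2 : (compositionBlocks (n + 1)).map ((fun l : List ℕ =>
        C ((graftProd c y i l)⁻¹ * φ (c (i + (n + 1 + 1)))) * X ^ (l.length - 1)) ∘ enlargeHead) =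
        (compositionBlocks (n + 1)).map fun l => C (c (i + 1) - y)⁻¹ *
          (C ((graftProd c y (i + 1) l)⁻¹ * φ (c (i + 1 + (n + 1)))) * X ^ (l.length - 1)) := by
      refine List.map_congr_left fun l hl => ?_
      simp only [Function.comp, graftProd_enlargeHead c y i l (len l hl), e]
      obtain ⟨k, l, rfl⟩ := List.exists_cons_of_ne_nil (len l hl)
      simp only [enlargeHead, mul_inv, C_mul, List.length_cons]
      ring
    rw [compositionBlocks, List.map_append, List.sum_append, List.map_map, List.map_map, h1, h2,
      List.sum_map_mul_left, List.sum_map_mul_left, ih, ih, segment_succ c i (n + 1), vineSum]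
    rw [segment_succ, counit]
    simp only [zero_mul, C_0]
    ring

/-- The functional `t^{h-1} ↦ (-1)^{h+1} / h`. -/
def logMap (K : Type*) [Field K] : K[X] →ₗ[K] K :=
  momentMap K fun k => (-1) ^ k / ((k : K) + 1)

theorem sum_vine_eq_logMap (c : ℕ → K) (hc : c 0 = 0) (n : ℕ) :
    ∑ v : Vine (n + 1), (-1) ^ (Vine.height v + 1) / (Vine.height v : K) *
      (1 / ((∏ e ∈ Vine.edges v, (c e.2 - c e.1)) * c (n + 1))) =
      logMap K (vineSum (fun a => a⁻¹) 0 (segment c 0 (n + 1))) := by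
  rw [← sum_compositionBlocks_eq_vineSum, ← sum_composition_eq, map_sum]
  refine Finset.sum_congr rfl fun v _ => ?_
  rw [Vine.edges, prod_graftEdges c _ fun k hk => v.blocks_pos hk, hc, Vine.height]
  -- Positive height makes the truncated `length - 1` a true difference; with `h = k + 1` the sign
  -- `(-1)^(h+1)` is `(-1)^k`.
  have hl : 0 < v.blocks.length := Composition.length_pos_of_pos v n.succ_pos
  rw [logMap, momentMap_C_mul, ← monomial_one_right_eq_X_pow, momentMap_monomial, Composition.length]
  obtain ⟨k, hk⟩ := Nat.exists_eq_add_of_lt hl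
  rw [zero_add] at hk
  rw [hk, Nat.add_sub_cancel, zero_add, pow_add, pow_succ]
  simp only [smul_eq_mul, one_div, mul_inv]
  push_cast
  ring

end Field

/-! ### Evaluation of rational functions -/

section Evaluation

variable {K : Type*} [Field K] [Algebra ℚ K] {d : ℕ}

/-- `f` is a fraction whose denominator does not vanish at `a`, and its value at `a` is `r`. -/
def EvaluatesTo (a : Fin d → K) (f : RatFun d) (r : K) : Prop :=
  ∃ P Q : MvPolynomial (Fin d) ℚ, MvPolynomial.aeval a Q ≠ 0 ∧
    f * algebraMap _ (RatFun d) Q = algebraMap _ (RatFun d) P ∧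
    r * MvPolynomial.aeval a Q = MvPolynomial.aeval a P

namespace EvaluatesTo

variable {a : Fin d → K} {f g : RatFun d} {r s : K}

/-- The reduced denominator is coprime to its numerator, so it divides the denominator of every
other fraction for `f`. Any fraction with denominator nonzero at `a` therefore gives the value. -/
theorem evalAt_eq (h : EvaluatesTo a f r) : evalAt a f = r := by
  obtain ⟨P, Q, hQ, hf, hr⟩ := h
  set N := IsFractionRing.num (MvPolynomial (Fin d) ℚ) f with hN
  set D := (IsFractionRing.den (MvPolynomial (Fin d) ℚ) f : MvPolynomial (Fin d) ℚ) with hD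
  have hD0 : algebraMap _ (RatFun d) D ≠ 0 :=
    IsFractionRing.to_map_ne_zero_of_mem_nonZeroDivisors (Subtype.prop _)
  have hfD : f * algebraMap _ (RatFun d) D = algebraMap _ (RatFun d) N := by
    have h := IsLocalization.mk'_spec (RatFun d) N (IsFractionRing.den (MvPolynomial (Fin d) ℚ) f)
    rwa [IsFractionRing.mk'_num_den] at h
  have hND : N * Q = P * D := by
    apply IsFractionRing.injective (MvPolynomial (Fin d) ℚ) (RatFun d)
    rw [map_mul, map_mul, ← hf, ← hfD]
    ring
  have hdvd : D ∣ Q :=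
    (IsFractionRing.num_den_reduced (MvPolynomial (Fin d) ℚ) f).symm.dvd_of_dvd_mul_left
      ⟨P, by rw [hND, mul_comm]⟩
  have hDa : MvPolynomial.aeval a D ≠ 0 := fun h => by
    obtain ⟨E, rfl⟩ := hdvd
    exact hQ (by rw [map_mul, h, zero_mul])
  rw [evalAt, div_eq_iff hDa]
  apply mul_right_cancel₀ hQ
  have := congrArg (MvPolynomial.aeval a) hND
  rw [map_mul, map_mul, ← hr] at this
  rw [this]
  ring

theorem of_polynomial (a : Fin d → K) (P : MvPolynomial (Fin d) ℚ) :
    EvaluatesTo a (algebraMap _ (RatFun d) P) (MvPolynomial.aeval a P) :=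
  ⟨P, 1, by simp, by simp, by simp⟩

theorem add (hf : EvaluatesTo a f r) (hg : EvaluatesTo a g s) :
    EvaluatesTo a (f + g) (r + s) := by
  obtain ⟨P, Q, hQ, h1, h2⟩ := hf
  obtain ⟨P', Q', hQ', h1', h2'⟩ := hg
  refine ⟨P * Q' + P' * Q, Q * Q', by simp [hQ, hQ'], ?_, ?_⟩
  · simp only [map_mul, map_add, ← h1, ← h1']
    ring
  · simp only [map_mul, map_add, ← h2, ← h2']
    ring

theorem mul (hf : EvaluatesTo a f r) (hg : EvaluatesTo a g s) :
    EvaluatesTo a (f * g) (r * s) := by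
  obtain ⟨P, Q, hQ, h1, h2⟩ := hf
  obtain ⟨P', Q', hQ', h1', h2'⟩ := hg
  refine ⟨P * P', Q * Q', by simp [hQ, hQ'], ?_, ?_⟩
  · simp only [map_mul, ← h1, ← h1']
    ring
  · simp only [map_mul, ← h2, ← h2']
    ring

theorem inv (hf : EvaluatesTo a f r) (hr : r ≠ 0) : EvaluatesTo a f⁻¹ r⁻¹ := by
  obtain ⟨P, Q, hQ, h1, h2⟩ := hf
  have hP : MvPolynomial.aeval a P ≠ 0 := h2 ▸ mul_ne_zero hr hQ
  have hP0 : algebraMap _ (RatFun d) P ≠ 0 := fun h => hP (by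
    rw [(IsFractionRing.injective (MvPolynomial (Fin d) ℚ) (RatFun d)) (h.trans (map_zero _).symm),
      map_zero])
  have hf0 : f ≠ 0 := fun h => hP0 (by rw [← h1, h, zero_mul])
  refine ⟨Q, P, hP, ?_, ?_⟩
  · rw [← h1, inv_mul_cancel_left₀ hf0]
  · rw [← h2, inv_mul_cancel_left₀ hr]

theorem ratCast (a : Fin d → K) (q : ℚ) :
    EvaluatesTo a (algebraMap ℚ (RatFun d) q) (algebraMap ℚ K q) := by
  have h := of_polynomial a (MvPolynomial.C q)
  rwa [MvPolynomial.aeval_C, ← MvPolynomial.algebraMap_eq, ← IsScalarTower.algebraMap_apply] at h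

theorem sub (hf : EvaluatesTo a f r) (hg : EvaluatesTo a g s) :
    EvaluatesTo a (f - g) (r - s) := by
  have h := hf.add ((ratCast a (-1)).mul hg)
  simpa [sub_eq_add_neg] using h

theorem sum {ι : Type*} (I : Finset ι) {F : ι → RatFun d} {R : ι → K}
    (h : ∀ i ∈ I, EvaluatesTo a (F i) (R i)) : EvaluatesTo a (∑ i ∈ I, F i) (∑ i ∈ I, R i) := by
  classical
  induction I using Finset.induction_on with
  | empty => simpa using ratCast a 0
  | insert i I hi ih =>
    rw [Finset.sum_insert hi, Finset.sum_insert hi]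
    exact (h i (by simp)).add (ih fun j hj => h j (by simp [hj]))

theorem prod {ι : Type*} (I : Finset ι) {F : ι → RatFun d} {R : ι → K}
    (h : ∀ i ∈ I, EvaluatesTo a (F i) (R i)) : EvaluatesTo a (∏ i ∈ I, F i) (∏ i ∈ I, R i) := by
  classical
  induction I using Finset.induction_on with
  | empty => simpa using ratCast a 1
  | insert i I hi ih =>
    rw [Finset.prod_insert hi, Finset.prod_insert hi]
    exact (h i (by simp)).mul (ih fun j hj => h j (by simp [hj]))

end EvaluatesTo

/-- The letter `0` in front plays the role of `x_0`, and the default `0` matches the default of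
`coord` beyond the last index. -/
theorem evaluatesTo_coord (w : List K) (j : ℕ) :
    EvaluatesTo w.get (coord w.length j) ((0 :: w).getD j 0) := by
  cases j with
  | zero => simpa [coord] using EvaluatesTo.ratCast w.get 0
  | succ k =>
    rw [coord, List.getD_cons_succ]
    split_ifs with h
    · have := EvaluatesTo.of_polynomial w.get (MvPolynomial.X ⟨k, h⟩)
      rw [MvPolynomial.aeval_X] at this
      rwa [List.getD_eq_getElem _ _ h]
    · rw [List.getD_eq_default _ _ (not_lt.1 h)]
      simpa using EvaluatesTo.ratCast w.get 0

theorem algebraMap_sign_div {L : Type*} [Field L] [Algebra ℚ L] (h : ℕ) :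
    algebraMap ℚ L ((-1) ^ (h + 1) / (h : ℚ)) = (-1) ^ (h + 1) / (h : L) := by
  simp

theorem segment_getD {L : Type*} [Zero L] (w : List L) :
    segment (fun j => (0 :: w).getD j 0) 0 w.length = w := by
  refine List.ext_getElem (by simp [segment]) fun i h1 h2 => ?_
  simp [segment, h2]

theorem getD_sub_ne_zero {L : Type*} [AddGroup L] {l : List L} (hl : l.Nodup) {i j : ℕ} (hij : i < j) (hj : j < l.length) :
    l.getD j 0 - l.getD i 0 ≠ 0 := by
  rw [List.getD_eq_getElem _ _ hj, List.getD_eq_getElem _ _ (hij.trans hj), sub_ne_zero]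
  intro h
  have := (hl.getElem_inj_iff).1 h
  omega

/-- Distinctness of `0` and the letters makes every edge factor and `x_d` nonzero at `w`, so the
evaluation passes through the sum over vines. -/
theorem evalWord_psiNegOne (w : List K) (hw : (0 :: w).Nodup) :
    evalWord psiNegOne w = logMap K (vineSum (fun a => a⁻¹) 0 w) := by
  cases w with
  | nil => simp [evalWord, vineSum]
  | cons b w =>
    have hs := sum_vine_eq_logMap (fun j => (0 :: b :: w).getD j 0) rfl w.length
    rw [show w.length + 1 = (b :: w).length from rfl, segment_getD] at hs
    rw [← hs, evalWord]
    apply EvaluatesTo.evalAt_eq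
    refine EvaluatesTo.sum _ fun v _ => ?_
    refine EvaluatesTo.mul ?_ ?_
    · have := EvaluatesTo.ratCast (b :: w).get ((-1) ^ (Vine.height v + 1) / (Vine.height v : ℚ))
      rwa [algebraMap_sign_div, algebraMap_sign_div] at this
    · rw [one_div, one_div]
      refine EvaluatesTo.inv (EvaluatesTo.mul (EvaluatesTo.prod _ fun e _ =>
        (evaluatesTo_coord _ _).sub (evaluatesTo_coord _ _)) (evaluatesTo_coord _ _)) ?_
      refine mul_ne_zero (Finset.prod_ne_zero_iff.2 fun e he => ?_) ?_
      · have h := lt_and_le_of_mem_edges he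
        exact getD_sub_ne_zero hw h.1 (Nat.lt_succ_of_le h.2)
      · have h := getD_sub_ne_zero hw (i := 0) (j := (b :: w).length) (by simp) (by simp)
        simpa using h

end Evaluation

/-! ### Poles and homogeneity -/

theorem coord_ne {d i j : ℕ} (hi : i ≤ d) (hj : j ≤ d) (hij : i ≠ j) : coord d i ≠ coord d j := by
  have inj := IsFractionRing.injective (MvPolynomial (Fin d) ℚ) (RatFun d)
  have pos : ∀ k, k + 1 ≤ d → coord d (k + 1) ≠ 0 := fun k hk h => by
    rw [coord, dif_pos (by omega)] at h
    exact MvPolynomial.X_ne_zero _ (inj (h.trans (map_zero _).symm))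
  match i, j with
  | 0, 0 => exact absurd rfl hij
  | 0, k + 1 => exact (pos k hj).symm
  | k + 1, 0 => exact pos k hi
  | k + 1, l + 1 =>
    rw [coord, coord, dif_pos (by omega), dif_pos (by omega)]
    intro h
    have := MvPolynomial.X_injective (inj h)
    simp only [Fin.mk.injEq] at this
    omega

theorem inv_coord_sub_mem_polarRing {d i j : ℕ} (hij : i < j) (hj : j ≤ d) :
    (coord d j - coord d i)⁻¹ ∈ polarRing d := by
  cases i with
  | zero =>
    rw [coord.eq_1, sub_zero]
    exact Algebra.subset_adjoin (Or.inl (Or.inr ⟨j, hij, hj, rfl⟩))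
  | succ i =>
    rw [← neg_sub, inv_neg]
    exact neg_mem (Algebra.subset_adjoin (Or.inr ⟨i + 1, j, by omega, hij, hj, rfl⟩))

theorem psiNegOne_mem_polarSeries : psiNegOne ∈ polarSeries := by
  intro d
  refine sum_mem fun v _ => mul_mem ?_ ?_
  · rw [← algebraMap_sign_div]
    exact Subalgebra.algebraMap_mem _ _
  · rw [one_div, mul_inv, Vine.x, ← Finset.prod_inv_distrib]
    refine mul_mem (prod_mem fun e he => ?_) ?_
    · have h := lt_and_le_of_mem_edges he
      exact inv_coord_sub_mem_polarRing h.1 h.2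
    · have h := inv_coord_sub_mem_polarRing (d := d) d.pos le_rfl
      rwa [coord.eq_1, sub_zero] at h

/-! ### Calculus of homogeneous rational functions -/

namespace IsHomogeneousRat

variable {d : ℕ} {f g : RatFun d} {m n : ℤ}

theorem algebraMap_ne_zero {q : MvPolynomial (Fin d) ℚ} (hq : q ≠ 0) :
    algebraMap _ (RatFun d) q ≠ 0 := fun h =>
  hq (IsFractionRing.injective (MvPolynomial (Fin d) ℚ) (RatFun d) (h.trans (map_zero _).symm))

theorem add (hf : IsHomogeneousRat f m) (hg : IsHomogeneousRat g m) :
    IsHomogeneousRat (f + g) m := by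
  obtain ⟨p, q, a, b, hp, hq, hq0, hm, rfl⟩ := hf
  obtain ⟨p', q', a', b', hp', hq', hq0', hm', rfl⟩ := hg
  have e : b + a' = a + b' := by omega
  refine ⟨p * q' + q * p', q * q', a + b', b + b', (hp.mul hq').add (e ▸ hq.mul hp'), hq.mul hq',
    mul_ne_zero hq0 hq0', by push_cast; omega, ?_⟩
  rw [div_add_div _ _ (algebraMap_ne_zero hq0) (algebraMap_ne_zero hq0')]
  simp only [map_add, map_mul]

theorem mul (hf : IsHomogeneousRat f m) (hg : IsHomogeneousRat g n) :
    IsHomogeneousRat (f * g) (m + n) := by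
  obtain ⟨p, q, a, b, hp, hq, hq0, hm, rfl⟩ := hf
  obtain ⟨p', q', a', b', hp', hq', hq0', hm', rfl⟩ := hg
  refine ⟨p * p', q * q', a + a', b + b', hp.mul hp', hq.mul hq', mul_ne_zero hq0 hq0',
    by push_cast; omega, ?_⟩
  rw [div_mul_div_comm, map_mul, map_mul]

theorem inv (hf : IsHomogeneousRat f m) (h0 : f ≠ 0) : IsHomogeneousRat f⁻¹ (-m) := by
  obtain ⟨p, q, a, b, hp, hq, hq0, hm, rfl⟩ := hf
  exact ⟨q, p, b, a, hq, hp, fun h => h0 (by simp [h]), by omega, inv_div _ _⟩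

theorem of_polynomial {p : MvPolynomial (Fin d) ℚ} {a : ℕ} (hp : p.IsHomogeneous a) :
    IsHomogeneousRat (algebraMap _ (RatFun d) p) a :=
  ⟨p, 1, a, 0, hp, MvPolynomial.isHomogeneous_one _ _, one_ne_zero, by simp, by simp⟩

theorem ratCast (q : ℚ) : IsHomogeneousRat (algebraMap ℚ (RatFun d) q) 0 := by
  have h := of_polynomial (MvPolynomial.isHomogeneous_C (Fin d) q)
  rwa [← MvPolynomial.algebraMap_eq, ← IsScalarTower.algebraMap_apply] at h

theorem coord {k : ℕ} (hk : k ≤ d) : IsHomogeneousRat (coord d k) 1 := by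
  cases k with
  | zero =>
    rw [PolarDoubleShuffle.coord.eq_1, ← map_zero (algebraMap (MvPolynomial (Fin d) ℚ) (RatFun d))]
    exact of_polynomial (MvPolynomial.isHomogeneous_zero _ _ 1)
  | succ k =>
    rw [PolarDoubleShuffle.coord, dif_pos (by omega)]
    exact of_polynomial (MvPolynomial.isHomogeneous_X _ _)

theorem sub (hf : IsHomogeneousRat f m) (hg : IsHomogeneousRat g m) :
    IsHomogeneousRat (f - g) m := by
  have h := (ratCast (-1)).mul hg
  rw [zero_add] at h
  simpa [sub_eq_add_neg] using hf.add h

theorem sum {ι : Type*} (I : Finset ι) (hI : I.Nonempty) {F : ι → RatFun d}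
    (h : ∀ i ∈ I, IsHomogeneousRat (F i) m) : IsHomogeneousRat (∑ i ∈ I, F i) m :=
  Finset.sum_induction_nonempty F (IsHomogeneousRat · m) (fun _ _ => add) hI h

theorem prod {ι : Type*} (I : Finset ι) {F : ι → RatFun d}
    (h : ∀ i ∈ I, IsHomogeneousRat (F i) 1) : IsHomogeneousRat (∏ i ∈ I, F i) I.card := by
  classical
  induction I using Finset.induction_on with
  | empty => simpa using ratCast (d := d) 1
  | insert i I hi ih =>
    rw [Finset.prod_insert hi, Finset.card_insert_of_notMem hi]
    have := (h i (by simp)).mul (ih fun j hj => h j (by simp [hj]))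
    rwa [add_comm, ← Nat.cast_succ] at this

end IsHomogeneousRat

/-- A vine with `d` grapes has `d` edges, so `x_v x_d` has degree `d + 1`. -/
theorem isHomogeneousOfWeight_psiNegOne : IsHomogeneousOfWeight psiNegOne (-1) := by
  intro d
  refine IsHomogeneousRat.sum _ ⟨Composition.ones d, Finset.mem_univ _⟩ fun v _ => ?_
  rw [← algebraMap_sign_div, one_div]
  have hx : IsHomogeneousRat (Vine.x v) (d : ℕ) := by
    have h := IsHomogeneousRat.prod (Vine.edges v) fun e he =>
      (IsHomogeneousRat.coord (lt_and_le_of_mem_edges he).2).sub (IsHomogeneousRat.coord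
        ((lt_and_le_of_mem_edges he).1.le.trans (lt_and_le_of_mem_edges he).2))
    rwa [card_edges] at h
  have hx0 : Vine.x v ≠ 0 := Finset.prod_ne_zero_iff.2 fun e he => by
    have h := lt_and_le_of_mem_edges he
    exact sub_ne_zero.2 (coord_ne h.2 (h.1.le.trans h.2) h.1.ne')
  have hd0 : coord d d ≠ 0 := coord_ne (j := 0) le_rfl (Nat.zero_le _) d.ne_zero
  have h := (IsHomogeneousRat.ratCast ((-1) ^ (Vine.height v + 1) / (Vine.height v : ℚ))).mul
    ((hx.mul (IsHomogeneousRat.coord (d := d) le_rfl)).inv (mul_ne_zero hx0 hd0))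
  convert h using 1
  ring

/-! ### The double shuffle equations -/

theorem coordWord_append (n p q : ℕ) :
    coordWord n 0 p ++ coordWord n p q = coordWord n 0 (p + q) := by
  simp only [coordWord, List.range_add, List.map_append, List.map_map, zero_add]
  rfl

theorem nodup_zero_cons_coordWord (n : ℕ) : (0 :: coordWord n 0 n).Nodup := by
  have h : (0 :: coordWord n 0 n) = (List.range (n + 1)).map (coord n) := by
    rw [List.range_succ_eq_map, List.map_cons, List.map_map, coordWord]
    simp only [zero_add]
    rfl
  rw [h]
  refine List.Nodup.map_on (fun i hi j hj hij => ?_) List.nodup_range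
  rw [List.mem_range] at hi hj
  by_contra hne
  exact coord_ne (by omega) (by omega) hne hij

theorem stuffleEquations_psiNegOne : StuffleEquations psiNegOne := by
  intro p q hp hq
  rw [onStuffle_eq_stuffleSum]
  have hn := nodup_zero_cons_coordWord (p + q)
  rw [← coordWord_append] at hn
  have hc := stuffleSum_congr (F := evalWord psiNegOne)
    (G := fun w => logMap (RatFun (p + q)) (vineSum (fun a => a⁻¹) 0 w))
    (u := coordWord (p + q) 0 p) (v := coordWord (p + q) p q) fun w hw => by
      -- Every word of the stuffle product inherits distinct nonzero letters from the full word of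
      -- coordinates.
      obtain ⟨l, hl, hsub⟩ := (List.subperm_cons 0).2 hw
      exact evalWord_psiNegOne w (hl.nodup_iff.1 (hn.sublist hsub))
  rw [hc, ← map_stuffleSum]
  have hs := stuffleSum_vineSum (0 : RatFun (p + q)) (coordWord (p + q) 0 p) (coordWord (p + q) p q)
    (by simp [coordWord]; omega) (by simp [coordWord]; omega) (List.nodup_cons.1 hn).2
    (List.nodup_cons.1 hn).1
  simp only [sub_zero] at hs
  rw [hs, map_zero]

/-- The rational functions given by polynomials which are positive at `(1, …, 1)`. -/
def positiveCone (n : ℕ) : AddSubsemigroup (RatFun n) where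
  carrier := {f | ∃ P : MvPolynomial (Fin n) ℚ, 0 < MvPolynomial.eval (fun _ => 1) P ∧
    algebraMap _ (RatFun n) P = f}
  add_mem' := by
    rintro _ _ ⟨P, hP, rfl⟩ ⟨Q, hQ, rfl⟩
    exact ⟨P + Q, by rw [map_add]; positivity, map_add _ _ _⟩

theorem zero_notMem_positiveCone (n : ℕ) : (0 : RatFun n) ∉ positiveCone n := by
  rintro ⟨P, hP, h⟩
  rw [IsFractionRing.injective (MvPolynomial (Fin n) ℚ) (RatFun n) (h.trans (map_zero _).symm),
    map_zero] at hP
  exact lt_irrefl _ hP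

theorem coord_mem_positiveCone {n k : ℕ} (hk : k < n) : coord n (k + 1) ∈ positiveCone n := by
  rw [coord, dif_pos hk]
  exact ⟨MvPolynomial.X ⟨k, hk⟩, by simp, rfl⟩

theorem mem_positiveCone_of_mem_coordWord {n m k : ℕ} (h : m + k ≤ n) :
    ∀ x ∈ coordWord n m k, x ∈ positiveCone n := by
  intro x hx
  obtain ⟨i, hi, rfl⟩ := List.mem_map.1 hx
  rw [List.mem_range] at hi
  exact coord_mem_positiveCone (by omega)

/-! ### Distinctness and last term of partial sums -/

section PartialSums

variable {K : Type*} [Field K]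

theorem sub_mem_of_mem_partialSums (S : AddSubsemigroup K) (w : List K) (hw : ∀ x ∈ w, x ∈ S)
    (p x : K) (hx : x ∈ partialSums p w) : x - p ∈ S := by
  induction w generalizing p with
  | nil => simp [partialSums] at hx
  | cons a w ih =>
    rw [partialSums, List.mem_cons] at hx
    rcases hx with rfl | hx
    · simpa using hw a (by simp)
    · have h := S.add_mem (ih (fun y hy => hw y (by simp [hy])) (p + a) hx) (hw a (by simp))
      rwa [← sub_sub, sub_add_cancel] at h

/-- The difference of two of these entries is a nonempty sum of letters, which lies in `S`. This
supplies the hypothesis of `evalWord_psiNegOne` after `♯`. -/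
theorem nodup_cons_partialSums (S : AddSubsemigroup K) (hS : (0 : K) ∉ S) (w : List K)
    (hw : ∀ x ∈ w, x ∈ S) (p : K) : (p :: partialSums p w).Nodup := by
  induction w generalizing p with
  | nil => simp [partialSums]
  | cons a w ih =>
    refine List.nodup_cons.2 ⟨fun h => hS ?_, ih (fun x hx => hw x (by simp [hx])) (p + a)⟩
    simpa using sub_mem_of_mem_partialSums S (a :: w) hw p p h

theorem partialSums_ne_nil {p : K} {w : List K} (hw : w ≠ []) : partialSums p w ≠ [] := by
  cases w <;> simp_all [partialSums]

theorem getLast_partialSums (p : K) (w : List K) (hw : partialSums p w ≠ []) :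
    (partialSums p w).getLast hw = p + w.sum := by
  induction w generalizing p with
  | nil => simp [partialSums] at hw
  | cons a w ih =>
    cases w with
    | nil => simp [partialSums]
    | cons b w =>
      have h := ih (p + a) (partialSums_ne_nil (by simp))
      simp only [partialSums, List.getLast_cons_cons, List.sum_cons, add_assoc] at h ⊢
      exact h

end PartialSums

theorem shuffleEquations_psiNegOne : ShuffleEquations psiNegOne := by
  intro p q hp hq
  rw [onShuffle_eq_shuffleSum]
  have hu := mem_positiveCone_of_mem_coordWord (n := p + q) (m := 0) (k := p) (by omega)
  have hv := mem_positiveCone_of_mem_coordWord (n := p + q) (m := p) (k := q) le_rfl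
  have hu0 : coordWord (p + q) 0 p ≠ [] := by simp [coordWord]; omega
  have hv0 : coordWord (p + q) p q ≠ [] := by simp [coordWord]; omega
  generalize coordWord (p + q) 0 p = u at *
  generalize coordWord (p + q) p q = v at *
  have hS := zero_notMem_positiveCone (p + q)
  -- The factor `1/x_d` becomes the inverse of the total sum of letters, the same for every word of
  -- the shuffle.
  rw [shuffleSum_congr (G := fun w => ((u ++ v).sum)⁻¹ *
    logMap (RatFun (p + q)) (vineSum (fun _ => 1) 0 (partialSums 0 w))), shuffleSum_const_mul]
  · exact mul_eq_zero_of_right _ (shuffleSum_log _ hS u v hu hv hu0 hv0)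
  · intro w hw
    have hwS : ∀ x ∈ w, x ∈ positiveCone (p + q) := fun x hx =>
      (List.mem_append.1 (hw.subset hx)).elim (hu x) (hv x)
    have hw0 : w ≠ [] := fun h => hu0 (List.append_eq_nil_iff.1 (h ▸ hw).symm.eq_nil).1
    rw [sharp, tail_scanl_eq_partialSums,
      evalWord_psiNegOne _ (nodup_cons_partialSums _ hS w hwS 0),
      vineSum_eq_mul_getLast _ _ _ (partialSums_ne_nil hw0), getLast_partialSums, zero_add,
      hw.sum_eq, logMap, momentMap_C_mul, smul_eq_mul]

end PolarDoubleShuffle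

end

theorem mainTheorem2 :
    PolarDoubleShuffle.psiNegOne ∈ PolarDoubleShuffle.pdmr ∧
      PolarDoubleShuffle.IsHomogeneousOfWeight PolarDoubleShuffle.psiNegOne (-1) :=
  ⟨⟨PolarDoubleShuffle.psiNegOne_mem_polarSeries, PolarDoubleShuffle.shuffleEquations_psiNegOne,
    PolarDoubleShuffle.stuffleEquations_psiNegOne⟩,
    PolarDoubleShuffle.isHomogeneousOfWeight_psiNegOne⟩
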